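/- Let $d\ge 1$, and let $\alpha_1,\dots,\alpha_d,\delta_1,\dots,\delta_d$ be real numbers with $2\sum_{i=1}^d\alpha_i=1$ and, for all $i$, $\delta_i\ge 0$ and $\alpha_i-\delta_i/2>0$. Let $\mathbf 1_i$ be the $i$-th unit vector of $\mathbb{Z}^d$, and let $\mathbf S_t=(S_t^{(1)},\dots,S_t^{(d)})$, $t=0,1,2,\dots$, be a random walk in $\mathbb{Z}^d$ with $\mathbf S_0=\mathbf 0$ such that, conditionally on $\mathbf S_0,\dots,\mathbf S_{t}$, the increment $\mathbf e_{t+1}=\mathbf S_{t+1}-\mathbf S_{t}$ takes each of the values $\mathbf 1_i$ and $-\mathbf 1_i$ with probability $\beta_i\big(S_{t}^{(i)}\big)$, $i=1,\dots,d$, and the value $\mathbf 0$ with the complementary probability $1-2\sum_{i=1}^d\beta_i\big(S_{t}^{(i)}\big)$. Here either (Model 2) $\beta_i(0)=\alpha_i$ and $\beta_i(k)=\alpha_i-\delta_i/2$ for all $i$ and all $k\neq0$, or (Model 3) $\beta_i(0)=\alpha_i-\delta_i/2$ and $\beta_i(k)=\alpha_i$ for all $i$ and all $k\neq 0$. In each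 of the two models, if $d\le 2$, then the walk is recurrent: almost surely it visits every point of $\mathbb{Z}^d$ (in particular the origin) infinitely many times. If $d\ge 3$, then the walk is transient: almost surely it visits every point of $\mathbb{Z}^d$ only finitely many times. -/

import Mathlib

open MeasureTheory Filter

namespace LatticeWalk

/-- Probability that a walk on `ℤ^d`, presently at `x`, takes the step `v`: each of the steps
`+1_i` and `-1_i` has probability `β i (x i)`, and the walk stays put with the complementary
probability. Every other step has probability zero. -/
noncomputable def stepProb {d : ℕ} (β : Fin d → ℤ → ℝ) (x v : Fin d → ℤ) : ℝ :=
  (∑ i, ((if v = Pi.single i 1 then β i (x i) else 0) +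
      (if v = -Pi.single i 1 then β i (x i) else 0))) +
    (if v = 0 then 1 - 2 * ∑ i, β i (x i) else 0)

/-- `S` is a random walk on `ℤ^d` started at the origin such that, conditionally on the whole
history `S 0, …, S t`, the increment `S (t + 1) - S t` has the law `stepProb β (S t)`. -/
structure IsWalk {d : ℕ} (β : Fin d → ℤ → ℝ) {Ω : Type*} [MeasurableSpace Ω] (μ : Measure Ω)
    (S : ℕ → Ω → Fin d → ℤ) : Prop where
  measurable : ∀ t, Measurable (S t)
  start : ∀ᵐ ω ∂μ, S 0 ω = 0
  step : ∀ (t : ℕ) (x : ℕ → Fin d → ℤ) (v : Fin d → ℤ),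
    μ.real {ω | (∀ s ≤ t, S s ω = x s) ∧ S (t + 1) ω - S t ω = v} =
      μ.real {ω | ∀ s ≤ t, S s ω = x s} * stepProb β (x t) v

/-- Model 2: the probability is `α i` on `{x i = 0}`, and `α i - δ i / 2` off it. -/
noncomputable def rateModel2 {d : ℕ} (α δ : Fin d → ℝ) (i : Fin d) (k : ℤ) : ℝ :=
  if k = 0 then α i else α i - δ i / 2

/-- Model 3: the probability is `α i - δ i / 2` on `{x i = 0}`, and `α i` off it. -/
noncomputable def rateModel3 {d : ℕ} (α δ : Fin d → ℝ) (i : Fin d) (k : ℤ) : ℝ :=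
  if k = 0 then α i - δ i / 2 else α i

/-- Almost surely every state (in particular the starting point) is visited infinitely often. -/
def IsRecurrent {d : ℕ} {Ω : Type*} [MeasurableSpace Ω] (μ : Measure Ω)
    (S : ℕ → Ω → Fin d → ℤ) : Prop :=
  ∀ᵐ ω ∂μ, ∀ x : Fin d → ℤ, ∃ᶠ t in atTop, S t ω = x

/-- Almost surely every state (in particular the starting point) is visited only finitely often. -/
def IsTransient {d : ℕ} {Ω : Type*} [MeasurableSpace Ω] (μ : Measure Ω)
    (S : ℕ → Ω → Fin d → ℤ) : Prop :=
  ∀ᵐ ω ∂μ, ∀ x : Fin d → ℤ, ∀ᶠ t in atTop, S t ω ≠ x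

end LatticeWalk

namespace LatticeWalk

/-! The two models enter only through bounds `0 < b ≤ β i k ≤ B`. Since `β i` reads the i-th
coordinate alone, the walk is reversible for `weight β`, and the edge (x, x + 1_i) has conductance
∏_{j ≠ i} 1 / β j (x j), the same seen from either end. So it is a walk on a network over ℤ^d with
conductances between positive constants, and Dirichlet forms (`energy`) decide its type.

Suppose that values at points are bounded by the energy among finitely supported functions vanishing
on `K`. The truncated Green function G_N of the walk killed on `K` satisfies E(G_N, G_N) = ⟨G_N,
q_0⟩ - ⟨G_N, q_N⟩, so its energy is bounded in N and the expected numbers of visits are finite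
(`summable_visits`).

For d ≥ 3 take `K = ∅`: the bound comes from pairing gradients with a unit flow of finite energy
(`hasPointBound_empty`), and Borel–Cantelli gives transience. For d ≤ 2 take `K = {x}`, with killing
from an arbitrary time m on. Logarithmic cut-offs equal to 1 at x with energy tending to 0 force the
surviving mass to 0 (`tendsto_mass`), so x is almost surely visited after every time m. -/

/-- Cauchy–Schwarz for series. -/
theorem tsum_mul_sq_le {κ : Type*} {f g : κ → ℝ} (hf : Summable fun k => f k ^ 2)
    (hg : Summable fun k => g k ^ 2) :
    (Summable fun k => f k * g k) ∧
      (∑' k, f k * g k) ^ 2 ≤ (∑' k, f k ^ 2) * ∑' k, g k ^ 2 := by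
  have hs : Summable fun k => f k * g k := by
    refine Summable.of_norm_bounded (hf.add hg) fun k => ?_
    rw [Real.norm_eq_abs, abs_le]
    constructor <;> nlinarith [sq_nonneg (f k + g k), sq_nonneg (f k - g k), sq_nonneg (f k),
      sq_nonneg (g k)]
  refine ⟨hs, ?_⟩
  refine le_of_tendsto_of_tendsto (hs.hasSum.pow 2) (Tendsto.mul hf.hasSum hg.hasSum)
    (Eventually.of_forall fun s => ?_)
  exact Finset.sum_mul_sq_le_sq_mul_sq s f g

/-! ### Dirichlet forms on the weighted lattice. -/

variable {d : ℕ}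

/-- The conductance-weighted difference operator `u ↦ ∑ i, c i (2 u - u (· + 1_i) - u (· - 1_i))`,
which is minus the weighted lattice Laplacian when `c i` is invariant under translation by `1_i`. -/
noncomputable def lap (c : Fin d → (Fin d → ℤ) → ℝ) (u : (Fin d → ℤ) → ℝ) (x : Fin d → ℤ) : ℝ :=
  ∑ i, c i x * (2 * u x - u (x + Pi.single i 1) - u (x - Pi.single i 1))

/-- Forward difference along the edge `(x, x + 1_i)`. -/
def grad (u : (Fin d → ℤ) → ℝ) (p : Fin d × (Fin d → ℤ)) : ℝ :=
  u (p.2 + Pi.single p.1 1) - u p.2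

/-- The Dirichlet form of the network with conductances `c`. -/
noncomputable def energy (c : Fin d → (Fin d → ℤ) → ℝ) (u g : (Fin d → ℤ) → ℝ) : ℝ :=
  ∑' p : Fin d × (Fin d → ℤ), c p.1 p.2 * (grad u p * grad g p)

theorem finite_support_shift {u : (Fin d → ℤ) → ℝ} (hu : u.support.Finite) (v : Fin d → ℤ) :
    (Function.support fun x => u (x + v)).Finite :=
  hu.preimage (f := fun x => x + v) (add_left_injective v).injOn

theorem finite_support_grad {u : (Fin d → ℤ) → ℝ} (hu : u.support.Finite) :
    (grad u).support.Finite := by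
  have h : ∀ i : Fin d, (Function.support fun x => grad u (i, x)).Finite := fun i =>
    ((finite_support_shift hu (Pi.single i 1)).union hu).subset (Function.support_sub _ _)
  refine (Set.finite_iUnion fun i => (h i).image (Prod.mk i)).subset fun p hp => ?_
  exact Set.mem_iUnion.2 ⟨p.1, p.2, hp, rfl⟩

theorem summable_energy {c : Fin d → (Fin d → ℤ) → ℝ} {u : (Fin d → ℤ) → ℝ}
    (hu : u.support.Finite) (g : (Fin d → ℤ) → ℝ) :
    Summable fun p : Fin d × (Fin d → ℤ) => c p.1 p.2 * (grad u p * grad g p) := by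
  refine summable_of_hasFiniteSupport ((finite_support_grad hu).subset fun p hp => ?_)
  intro h
  exact hp (by simp [h])

theorem energy_nonneg {c : Fin d → (Fin d → ℤ) → ℝ} (hc : ∀ i x, 0 ≤ c i x)
    (u : (Fin d → ℤ) → ℝ) : 0 ≤ energy c u u :=
  tsum_nonneg fun _ => mul_nonneg (hc _ _) (mul_self_nonneg _)

theorem energy_mono {c c' : Fin d → (Fin d → ℤ) → ℝ} (hc : ∀ i x, c i x ≤ c' i x)
    {u : (Fin d → ℤ) → ℝ} (hu : u.support.Finite) : energy c u u ≤ energy c' u u :=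
  (summable_energy hu u).tsum_le_tsum
    (fun _ => mul_le_mul_of_nonneg_right (hc _ _) (mul_self_nonneg _)) (summable_energy hu u)

theorem energy_const_mul (a : ℝ) (u : (Fin d → ℤ) → ℝ) :
    energy (fun _ _ => a) u u = a * energy (fun _ _ => 1) u u := by
  simp only [energy, one_mul, tsum_mul_left]

/-- The energy sees only differences. This allows testing against 1 - g, which vanishes where g = 1
although its support is infinite. -/
theorem energy_one_sub (c : Fin d → (Fin d → ℤ) → ℝ) (u g : (Fin d → ℤ) → ℝ) :
    energy c u (fun x => 1 - g x) = -energy c u g := by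
  rw [energy, energy, ← tsum_neg]
  congr 1 with p
  simp only [grad]
  ring

theorem energy_sq_le {c : Fin d → (Fin d → ℤ) → ℝ} (hc : ∀ i x, 0 ≤ c i x)
    {u g : (Fin d → ℤ) → ℝ} (hu : u.support.Finite) (hg : g.support.Finite) :
    energy c u g ^ 2 ≤ energy c u u * energy c g g := by
  have key : ∀ (a b : (Fin d → ℤ) → ℝ) (p : Fin d × (Fin d → ℤ)),
      c p.1 p.2 * (grad a p * grad b p) =
        (√(c p.1 p.2) * grad a p) * (√(c p.1 p.2) * grad b p) := fun a b p => by
    linear_combination (-grad a p * grad b p) * Real.mul_self_sqrt (hc p.1 p.2)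
  have hsq : ∀ a : (Fin d → ℤ) → ℝ, a.support.Finite →
      Summable fun p : Fin d × (Fin d → ℤ) => (√(c p.1 p.2) * grad a p) ^ 2 := fun a ha => by
    have h := summable_energy (c := c) ha a
    simp only [key] at h
    simpa only [sq] using h
  have := (tsum_mul_sq_le (hsq u hu) (hsq g hg)).2
  simpa only [energy, key, sq (_ * grad _ _)] using this

/-- Summation by parts. -/
theorem tsum_mul_lap {c : Fin d → (Fin d → ℤ) → ℝ}
    (hc : ∀ i x, c i (x + Pi.single i 1) = c i x) {u : (Fin d → ℤ) → ℝ} (hu : u.support.Finite)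
    (g : (Fin d → ℤ) → ℝ) : ∑' x, g x * lap c u x = energy c u g := by
  have hfin : ∀ (i : Fin d) (h : (Fin d → ℤ) → ℝ),
      Summable fun x => h x * grad u (i, x) := fun i h => by
    refine summable_of_hasFiniteSupport
      (((finite_support_shift hu (Pi.single i 1)).union hu).subset fun x hx => ?_)
    refine Function.support_sub (fun x => u (x + Pi.single i 1)) u ?_
    exact fun h0 => hx (mul_eq_zero_of_right _ h0)
  -- The backward difference at x is the forward difference at x - 1_i; reindexing moves the
  -- translation onto the other factor.
  have hshift : ∀ (i : Fin d) (h : (Fin d → ℤ) → ℝ), HasSum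
      (fun x => h x * grad u (i, x - Pi.single i 1))
      (∑' x, h (x + Pi.single i 1) * grad u (i, x)) := fun i h => by
    have := (Equiv.subRight (Pi.single i (1 : ℤ))).hasSum_iff.2
      (hfin i (fun x => h (x + Pi.single i 1))).hasSum
    simpa [Function.comp_def] using this
  have h1 : ∀ i : Fin d, HasSum
      (fun x => g x * (c i x * (2 * u x - u (x + Pi.single i 1) - u (x - Pi.single i 1))))
      (∑' x, c i x * (grad u (i, x) * grad g (i, x))) := fun i => by
    have h2 := (hshift i fun x => g x * c i x).sub (hfin i fun x => g x * c i x).hasSum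
    have h3 := ((hfin i fun x => g (x + Pi.single i 1) * c i (x + Pi.single i 1))).tsum_sub
      (hfin i fun x => g x * c i x)
    beta_reduce at h2 h3
    rw [← h3] at h2
    rw [tsum_congr (g := fun x => g (x + Pi.single i 1) * c i (x + Pi.single i 1) * grad u (i, x) -
      g x * c i x * grad u (i, x)) fun x => by simp only [hc, grad]; ring]
    have h4 : ∀ x, g x * (c i x * (2 * u x - u (x + Pi.single i 1) - u (x - Pi.single i 1))) =
        g x * c i x * grad u (i, x - Pi.single i 1) - g x * c i x * grad u (i, x) := fun x => by
      simp only [grad, sub_add_cancel]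
      ring
    simpa only [h4] using h2
  have h3 := (hasSum_sum fun i (_ : i ∈ Finset.univ) => h1 i).tsum_eq
  rw [energy, (summable_energy hu g).tsum_prod, tsum_fintype (β := Fin d), ← h3]
  simp only [lap, Finset.mul_sum]

theorem sq_grad_le_energy {c : Fin d → (Fin d → ℤ) → ℝ} {m : ℝ} (hm : 0 < m)
    (hc : ∀ i x, m ≤ c i x) {u : (Fin d → ℤ) → ℝ} (hu : u.support.Finite)
    (p : Fin d × (Fin d → ℤ)) : grad u p ^ 2 ≤ m⁻¹ * energy c u u := by
  have h := (summable_energy (c := c) hu u).le_tsum p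
    fun q _ => mul_nonneg (hm.le.trans (hc _ _)) (mul_self_nonneg _)
  have h2 : m * grad u p ^ 2 ≤ energy c u u := by
    refine le_trans ?_ h
    rw [sq]
    exact mul_le_mul_of_nonneg_right (hc _ _) (mul_self_nonneg _)
  rwa [inv_mul_eq_div, le_div_iff₀' hm]

/-- Differences of finitely supported functions between two given points are controlled by the
energy. -/
theorem exists_sq_sub_le_energy {c : Fin d → (Fin d → ℤ) → ℝ} {m : ℝ} (hm : 0 < m)
    (hc : ∀ i x, m ≤ c i x) (v : Fin d → ℤ) :
    ∃ C, ∀ (x : Fin d → ℤ) (u : (Fin d → ℤ) → ℝ), u.support.Finite →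
      (u (x + v) - u x) ^ 2 ≤ C * energy c u u := by
  -- The admissible shifts form a subgroup, because the constant is uniform in x; it contains the
  -- unit vectors, hence everything.
  let H : AddSubgroup (Fin d → ℤ) :=
    { carrier := {v | ∃ C, ∀ (x : Fin d → ℤ) (u : (Fin d → ℤ) → ℝ), u.support.Finite →
        (u (x + v) - u x) ^ 2 ≤ C * energy c u u}
      zero_mem' := ⟨0, fun x u _ => by simp⟩
      add_mem' := by
        rintro v w ⟨C, hC⟩ ⟨D, hD⟩
        refine ⟨2 * C + 2 * D, fun x u hu => ?_⟩
        have h1 := hC x u hu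
        have h2 := hD (x + v) u hu
        rw [← add_assoc]
        nlinarith [sq_nonneg (u (x + v + w) - u (x + v) - (u (x + v) - u x))]
      neg_mem' := by
        rintro v ⟨C, hC⟩
        refine ⟨C, fun x u hu => ?_⟩
        have h1 := hC (x + -v) u hu
        rw [neg_add_cancel_right] at h1
        linarith [sub_sq_comm (u x) (u (x + -v))] }
  have hs : ∀ i : Fin d, Pi.single i (1 : ℤ) ∈ H := fun i =>
    ⟨m⁻¹, fun x u hu => sq_grad_le_energy hm hc hu (i, x)⟩
  have hv : v = ∑ i, v i • Pi.single i (1 : ℤ) := by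
    ext j
    simp [Finset.sum_apply, Pi.single_apply]
  change v ∈ H
  rw [hv]
  exact H.sum_mem fun i _ => H.zsmul_mem (hs i) _

/-! ### Killed walks and their Green functions. -/

theorem lap_add (c : Fin d → (Fin d → ℤ) → ℝ) (u v : (Fin d → ℤ) → ℝ) (x : Fin d → ℤ) :
    lap c (fun y => u y + v y) x = lap c u x + lap c v x := by
  simp only [lap, ← Finset.sum_add_distrib]
  exact Finset.sum_congr rfl fun i _ => by ring

/-- `q n` is the sequence of laws of a walk on the network with conductances `c` and reversible
measure `w`, killed on entering `K`. -/
structure IsKilledEvolution (c : Fin d → (Fin d → ℤ) → ℝ) (w : (Fin d → ℤ) → ℝ)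
    (K : Set (Fin d → ℤ)) (q : ℕ → (Fin d → ℤ) → ℝ) : Prop where
  cond_nonneg : ∀ i x, 0 ≤ c i x
  cond_shift : ∀ i x, c i (x + Pi.single i 1) = c i x
  weight_pos : ∀ x, 0 < w x
  nonneg : ∀ n x, 0 ≤ q n x
  finite_support : ∀ n, (q n).support.Finite
  killed : ∀ n, ∀ x ∈ K, q n x = 0
  step : ∀ n, ∀ x ∉ K, q (n + 1) x = q n x - lap c (fun y => q n y / w y) x

/-- Every point has positive capacity relative to `K`. -/
def HasPointBound (c : Fin d → (Fin d → ℤ) → ℝ) (K : Set (Fin d → ℤ)) : Prop :=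
  ∀ z, ∃ C, ∀ u : (Fin d → ℤ) → ℝ, u.support.Finite → (∀ x ∈ K, u x = 0) →
    u z ^ 2 ≤ C * energy c u u

/-- Truncated Green function, as a density with respect to `w`. -/
noncomputable def green (w : (Fin d → ℤ) → ℝ) (q : ℕ → (Fin d → ℤ) → ℝ) (N : ℕ)
    (x : Fin d → ℤ) : ℝ :=
  ∑ n ∈ Finset.range N, q n x / w x

namespace IsKilledEvolution

variable {c : Fin d → (Fin d → ℤ) → ℝ} {w : (Fin d → ℤ) → ℝ} {K : Set (Fin d → ℤ)}
  {q : ℕ → (Fin d → ℤ) → ℝ}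

theorem green_nonneg (h : IsKilledEvolution c w K q) (N : ℕ) (x : Fin d → ℤ) : 0 ≤ green w q N x :=
  Finset.sum_nonneg fun n _ => div_nonneg (h.nonneg n x) (h.weight_pos x).le

theorem green_eq_zero (h : IsKilledEvolution c w K q) (N : ℕ) {x : Fin d → ℤ} (hx : x ∈ K) :
    green w q N x = 0 :=
  Finset.sum_eq_zero fun n _ => by rw [h.killed n x hx, zero_div]

theorem finite_support_green (h : IsKilledEvolution c w K q) (N : ℕ) :
    (green w q N).support.Finite := by
  refine ((Finset.range N).finite_toSet.biUnion fun n _ => h.finite_support n).subset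
    fun x hx => ?_
  obtain ⟨n, hn, hne⟩ := Finset.exists_ne_zero_of_sum_ne_zero hx
  exact Set.mem_biUnion hn fun h0 => hne (by rw [h0, zero_div])

/-- The one-step equation telescopes over n < N. -/
theorem lap_green (h : IsKilledEvolution c w K q) (N : ℕ) {x : Fin d → ℤ} (hx : x ∉ K) :
    lap c (green w q N) x = q 0 x - q N x := by
  induction N with
  | zero => simp [lap, green]
  | succ N ih =>
    have : green w q (N + 1) = fun y => green w q N y + q N y / w y :=
      funext fun y => Finset.sum_range_succ _ _
    rw [this, lap_add, ih, h.step N x hx]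
    ring

theorem summable_mul (h : IsKilledEvolution c w K q) (g : (Fin d → ℤ) → ℝ) (n : ℕ) :
    Summable fun x => g x * q n x :=
  summable_of_hasFiniteSupport ((h.finite_support n).subset fun _ hx h0 =>
    hx (mul_eq_zero_of_right _ h0))

/-- The expectation of a function that vanishes on `K`, in terms of the Green function. -/
theorem tsum_mul_eq (h : IsKilledEvolution c w K q) (N : ℕ) {g : (Fin d → ℤ) → ℝ}
    (hg : ∀ x ∈ K, g x = 0) :
    ∑' x, g x * q N x = ∑' x, g x * q 0 x - energy c (green w q N) g := by
  rw [← tsum_mul_lap h.cond_shift (h.finite_support_green N) g]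
  have h1 : ∀ x, g x * lap c (green w q N) x = g x * q 0 x - g x * q N x := fun x => by
    by_cases hx : x ∈ K
    · simp [hg x hx]
    · rw [h.lap_green N hx, mul_sub]
  simp only [h1]
  rw [(h.summable_mul g 0).tsum_sub (h.summable_mul g N)]
  ring

/-- Pair G_N with itself in `tsum_mul_eq` and drop ⟨G_N, q_N⟩ ≥ 0. The point bound at each atom of
q_0 then gives E ≤ A √E, hence E ≤ A². Absolute values appear because the constants `C x` carry no
sign. -/
theorem exists_energy_green_le (h : IsKilledEvolution c w K q) (hK : HasPointBound c K) :
    ∃ A, 0 ≤ A ∧ ∀ N, energy c (green w q N) (green w q N) ≤ A ^ 2 := by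
  choose C hC using hK
  refine ⟨∑' x, √|C x| * q 0 x, tsum_nonneg fun x => mul_nonneg (Real.sqrt_nonneg _)
    (h.nonneg 0 x), fun N => ?_⟩
  set E := energy c (green w q N) (green w q N) with hE
  set A := ∑' x, √|C x| * q 0 x
  have hE0 : 0 ≤ E := energy_nonneg h.cond_nonneg _
  have h1 := h.tsum_mul_eq N fun x hx => h.green_eq_zero N hx
  have h2 : 0 ≤ ∑' x, green w q N x * q N x :=
    tsum_nonneg fun x => mul_nonneg (h.green_nonneg N x) (h.nonneg N x)
  have h3 : ∑' x, green w q N x * q 0 x ≤ √E * A := by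
    rw [← tsum_mul_left]
    refine (h.summable_mul _ 0).tsum_le_tsum (fun x => ?_)
      ((h.summable_mul (fun x => √|C x|) 0).mul_left _)
    rw [← mul_assoc]
    refine mul_le_mul_of_nonneg_right ?_ (h.nonneg 0 x)
    rw [← Real.sqrt_mul hE0]
    refine Real.le_sqrt_of_sq_le ((hC x _ (h.finite_support_green N)
      fun x hx => h.green_eq_zero N hx).trans ?_)
    rw [mul_comm]
    exact mul_le_mul_of_nonneg_left (le_abs_self _) hE0
  have h4 : √E * √E ≤ √E * A := by
    rw [Real.mul_self_sqrt hE0]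
    linarith
  have hA : 0 ≤ A := tsum_nonneg fun x => mul_nonneg (Real.sqrt_nonneg _) (h.nonneg 0 x)
  rcases (Real.sqrt_nonneg E).eq_or_lt with h5 | h5
  · rw [← Real.sq_sqrt hE0, ← h5]
    exact pow_le_pow_left₀ le_rfl hA 2
  · rw [← Real.sq_sqrt hE0]
    exact pow_le_pow_left₀ h5.le (le_of_mul_le_mul_left h4 h5) 2

/-- The expected number of visits to any point before killing is finite. -/
theorem summable_visits (h : IsKilledEvolution c w K q) (hK : HasPointBound c K) (z : Fin d → ℤ) :
    Summable fun n => q n z := by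
  obtain ⟨A, -, hA⟩ := h.exists_energy_green_le hK
  obtain ⟨C, hC⟩ := hK z
  refine summable_of_sum_range_le (c := w z * √(|C| * A ^ 2)) (fun n => h.nonneg n z) fun N => ?_
  have h1 : ∑ n ∈ Finset.range N, q n z = w z * green w q N z := by
    rw [green, Finset.mul_sum]
    exact Finset.sum_congr rfl fun n _ => (mul_div_cancel₀ _ (h.weight_pos z).ne').symm
  rw [h1]
  refine mul_le_mul_of_nonneg_left ?_ (h.weight_pos z).le
  refine Real.le_sqrt_of_sq_le ((hC _ (h.finite_support_green N)
      fun x hx => h.green_eq_zero N hx).trans ?_)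
  exact mul_le_mul (le_abs_self _) (hA N) (energy_nonneg h.cond_nonneg _) (abs_nonneg _)

/-- If `K` has capacity zero, in the sense that `1` is a pointwise limit of finitely supported
functions equal to `1` on `K` whose energies tend to zero, then the walk is killed almost surely. -/
theorem tendsto_mass (h : IsKilledEvolution c w K q) (hK : HasPointBound c K)
    {f : ℕ → (Fin d → ℤ) → ℝ}
    (hf : ∀ k, (f k).support.Finite) (hf1 : ∀ k, ∀ x ∈ K, f k x = 1)
    (hlim : ∀ x, Tendsto (fun k => f k x) atTop (nhds 1))
    (hE : Tendsto (fun k => energy c (f k) (f k)) atTop (nhds 0)) :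
    Tendsto (fun n => ∑' x, q n x) atTop (nhds 0) := by
  obtain ⟨A, hA0, hA⟩ := h.exists_energy_green_le hK
  have hmass : ∀ n, 0 ≤ ∑' x, q n x := fun n => tsum_nonneg (h.nonneg n)
  -- Split 1 = (1 - f) + f. The first part vanishes on `K`, so the Green identity applies to it, and
  -- Cauchy–Schwarz bounds the energy term uniformly in n.
  have hbound : ∀ k n, ∑' x, q n x ≤
      (∑' x, (1 - f k x) * q 0 x + A * √(energy c (f k) (f k))) + ∑' x, f k x * q n x := by
    intro k n
    have h1 := h.tsum_mul_eq n (g := fun x => 1 - f k x) fun x hx => by simp [hf1 k x hx]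
    rw [energy_one_sub] at h1
    have h2 : ∑' x, q n x = ∑' x, (1 - f k x) * q n x + ∑' x, f k x * q n x := by
      rw [← (h.summable_mul (fun x => 1 - f k x) n).tsum_add (h.summable_mul (f k) n)]
      exact tsum_congr fun x => by ring
    have h3 : energy c (green w q n) (f k) ≤ A * √(energy c (f k) (f k)) := by
      rw [← Real.sqrt_sq hA0, ← Real.sqrt_mul (sq_nonneg A)]
      refine Real.le_sqrt_of_sq_le
        ((energy_sq_le h.cond_nonneg (h.finite_support_green n) (hf k)).trans ?_)
      exact mul_le_mul_of_nonneg_right (hA n) (energy_nonneg h.cond_nonneg _)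
    linarith
  have hk : Tendsto (fun k => ∑' x, (1 - f k x) * q 0 x + A * √(energy c (f k) (f k)))
      atTop (nhds 0) := by
    have h1 : ∀ k, ∑' x, (1 - f k x) * q 0 x =
        ∑ x ∈ (h.finite_support 0).toFinset, (1 - f k x) * q 0 x := fun k =>
      tsum_eq_sum fun x hx => by
        rw [Set.Finite.mem_toFinset, Function.notMem_support] at hx
        rw [hx, mul_zero]
    simp only [h1]
    have h2 : Tendsto (fun k => ∑ x ∈ (h.finite_support 0).toFinset, (1 - f k x) * q 0 x)
        atTop (nhds (∑ x ∈ (h.finite_support 0).toFinset, (1 - 1) * q 0 x)) :=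
      tendsto_finsetSum _ fun x _ => ((hlim x).const_sub 1).mul_const _
    simpa using h2.add ((Real.continuous_sqrt.tendsto 0 |>.comp hE).const_mul A)
  -- Only finitely many points matter for fixed k, and at each of them the summable sequence `q n x`
  -- tends to 0.
  have hn : ∀ k, Tendsto (fun n => ∑' x, f k x * q n x) atTop (nhds 0) := by
    intro k
    have h1 : ∀ n, ∑' x, f k x * q n x = ∑ x ∈ (hf k).toFinset, f k x * q n x := fun n =>
      tsum_eq_sum fun x hx => by
        rw [Set.Finite.mem_toFinset, Function.notMem_support] at hx
        rw [hx, zero_mul]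
    simp only [h1]
    have h2 : Tendsto (fun n => ∑ x ∈ (hf k).toFinset, f k x * q n x)
        atTop (nhds (∑ x ∈ (hf k).toFinset, f k x * 0)) :=
      tendsto_finsetSum _ fun x _ =>
        (h.summable_visits hK x).tendsto_atTop_zero.const_mul _
    simpa using h2
  rw [Metric.tendsto_atTop]
  intro ε hε
  obtain ⟨k, hk⟩ := (hk.eventually (gt_mem_nhds (half_pos hε))).exists
  obtain ⟨N, hN⟩ := eventually_atTop.1 ((hn k).eventually (gt_mem_nhds (half_pos hε)))
  refine ⟨N, fun n hnN => ?_⟩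
  rw [Real.dist_0_eq_abs, abs_of_nonneg (hmass n)]
  linarith [hbound k n, hN n hnN]

end IsKilledEvolution

/-! ### Dimension at least three: a flow of finite energy. -/

/-- The Pólya urn flow from the origin to infinity in the octant `ℕ^3`, which spreads its unit
mass uniformly on each simplex `x 0 + x 1 + x 2 = n`: its value on the edge `(x, x + 1_j)`. -/
noncomputable def urnFlow (j : Fin 3) (x : Fin 3 → ℕ) : ℝ :=
  2 * (x j + 1) / (((∑ k, x k : ℕ) + 1) * ((∑ k, x k : ℕ) + 2) * ((∑ k, x k : ℕ) + 3))

/-- On the simplex of level s the square is at most 4 (s + 1)^(-4). Writing 4 = 3 · (4/3) and using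
s ≥ x k for each k, this is dominated by a product of three convergent one-variable series; hence
the exponent 4/3. -/
theorem summable_urnFlow_sq (j : Fin 3) : Summable fun x => urnFlow j x ^ 2 := by
  let e : (Fin 3 → ℕ) ≃ ℕ × ℕ × ℕ :=
    { toFun := fun x => (x 0, x 1, x 2)
      invFun := fun p => ![p.1, p.2.1, p.2.2]
      left_inv := fun x => by ext k; fin_cases k <;> rfl
      right_inv := fun p => rfl }
  let g : ℕ → ℝ := fun n => ((n : ℝ) + 1) ^ (-(4 / 3) : ℝ)
  have hg0 : 0 ≤ g := fun n => by positivity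
  have hg : Summable g := by
    have h := (summable_nat_add_iff 1).2
      (Real.summable_nat_rpow.2 (by norm_num : (-(4 / 3) : ℝ) < -1))
    simpa [g] using h
  have h3 : Summable fun x : Fin 3 → ℕ => g (x 0) * (g (x 1) * g (x 2)) :=
    e.summable_iff.2 (hg.mul_of_nonneg (hg.mul_of_nonneg hg hg0 hg0) hg0
      fun p => mul_nonneg (hg0 _) (hg0 _))
  refine (h3.mul_left 4).of_nonneg_of_le (fun x => sq_nonneg _) fun x => ?_
  set s : ℕ := ∑ k, x k with hs
  have hle : ∀ k, x k ≤ s := fun k => Finset.single_le_sum (fun _ _ => Nat.zero_le _)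
    (Finset.mem_univ k)
  have hgs : ∀ k, g s ≤ g (x k) := fun k => by
    refine Real.rpow_le_rpow_of_nonpos (by positivity) ?_ (by norm_num)
    have : (x k : ℝ) ≤ s := Nat.cast_le.2 (hle k)
    linarith
  have hpow : g s * (g s * g s) = (((s : ℝ) + 1) ^ 4)⁻¹ := by
    have hp : (0 : ℝ) < (s : ℝ) + 1 := by positivity
    simp only [g]
    rw [← Real.rpow_add hp, ← Real.rpow_add hp, ← Real.rpow_natCast, ← Real.rpow_neg hp.le]
    norm_num
  have h1 : urnFlow j x ≤ 2 / ((s : ℝ) + 1) ^ 2 := by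
    have : (x j : ℝ) ≤ s := Nat.cast_le.2 (hle j)
    rw [urnFlow, ← hs, div_le_div_iff₀ (by positivity) (by positivity)]
    have h0 : (0 : ℝ) ≤ s := by positivity
    have h2 : ((x j : ℝ) + 1) * (s + 1) ^ 2 ≤ (s + 3) * ((s + 1) * (s + 2)) := by
      gcongr
      · linarith
      · nlinarith
    linarith
  have h0 : 0 ≤ urnFlow j x := by rw [urnFlow]; positivity
  calc urnFlow j x ^ 2 ≤ (2 / ((s : ℝ) + 1) ^ 2) ^ 2 := by gcongr
    _ = 4 * (g s * (g s * g s)) := by rw [hpow]; field_simp; norm_num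
    _ ≤ 4 * (g (x 0) * (g (x 1) * g (x 2))) := by
      have := hg0 s
      gcongr
      · exact hgs 0
      · exact hgs 1
      · exact hgs 2

/-- The urn flow has unit divergence at the origin and is divergence-free elsewhere. -/
theorem sum_tsum_urnFlow_mul {v : (Fin 3 → ℕ) → ℝ} (hv : v.support.Finite) :
    ∑ j, ∑' x, urnFlow j x * (v x - v (x + Pi.single j 1)) = v 0 := by
  -- `W j x` is the flow entering x in direction j. Its numerator vanishes on the face x j = 0, so
  -- it is 0 there, also at the origin where the denominator is 0.
  let W : Fin 3 → (Fin 3 → ℕ) → ℝ := fun j x =>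
    2 * (x j) / (((∑ k, x k : ℕ)) * ((∑ k, x k : ℕ) + 1) * ((∑ k, x k : ℕ) + 2))
  have hinj : ∀ j : Fin 3, Function.Injective fun x : Fin 3 → ℕ => x + Pi.single j 1 :=
    fun j => add_left_injective _
  have hsum : ∀ g : (Fin 3 → ℕ) → ℝ, Summable fun x => g x * v x := fun g =>
    summable_of_hasFiniteSupport (hv.subset fun _ hx h0 => hx (mul_eq_zero_of_right _ h0))
  have hflow : ∀ (j : Fin 3) (x : Fin 3 → ℕ), urnFlow j x = W j (x + Pi.single j 1) := fun j x => by
    simp only [urnFlow, W, Pi.add_apply, Finset.sum_add_distrib, Finset.sum_pi_single',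
      Finset.mem_univ, if_true, Pi.single_eq_same]
    push_cast
    congr 1
    ring
  have hW : ∀ j : Fin 3, ∀ x ∉ Set.range fun x : Fin 3 → ℕ => x + Pi.single j 1, W j x = 0 := by
    intro j x hx
    have : x j = 0 := by
      by_contra h0
      refine hx ⟨x - Pi.single j 1, funext fun k => ?_⟩
      rcases eq_or_ne k j with rfl | hk
      · simp only [Pi.add_apply, Pi.sub_apply, Pi.single_eq_same]; omega
      · simp [hk]
    simp [W, this]
  have h1 : ∀ j, ∑' x : Fin 3 → ℕ, urnFlow j x * (v x - v (x + Pi.single j 1)) =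
      ∑' x, (urnFlow j x - W j x) * v x := by
    intro j
    have hS : Summable fun x => W j (x + Pi.single j 1) * v (x + Pi.single j 1) :=
      (hsum (W j)).comp_injective (hinj j)
    have h2 : ∑' x : Fin 3 → ℕ, W j (x + Pi.single j 1) * v (x + Pi.single j 1) =
        ∑' x, W j x * v x := by
      refine (hinj j).tsum_eq (f := fun x => W j x * v x) fun x hx => ?_
      by_contra h0
      exact hx (by simp only [hW j x h0, zero_mul])
    have h3 : ∀ x, urnFlow j x * (v x - v (x + Pi.single j 1)) =
        urnFlow j x * v x - W j (x + Pi.single j 1) * v (x + Pi.single j 1) := fun x => by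
      rw [mul_sub, ← hflow]
    simp only [h3, sub_mul]
    rw [(hsum (urnFlow j)).tsum_sub hS, (hsum (urnFlow j)).tsum_sub (hsum (W j)), h2]
  simp only [h1]
  rw [← Summable.tsum_finsetSum fun j _ => hsum _, tsum_eq_single 0]
  · simp [Fin.sum_univ_three, urnFlow, W]
    ring
  · intro x hx
    rw [← Finset.sum_mul]
    refine mul_eq_zero_of_left ?_ _
    have hs : (0 : ℝ) < (∑ k, x k : ℕ) := by
      rw [Nat.cast_pos, Nat.pos_iff_ne_zero]
      intro h0
      exact hx (funext fun k => (Finset.sum_eq_zero_iff.1 h0) k (Finset.mem_univ k))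
    simp only [Fin.sum_univ_three, urnFlow, W] at hs ⊢
    push_cast at hs ⊢
    field_simp
    ring

/-- In dimension at least three, finitely supported functions are bounded by their energy. -/
theorem hasPointBound_empty (hd : 3 ≤ d) {c : Fin d → (Fin d → ℤ) → ℝ} {m : ℝ} (hm : 0 < m)
    (hc : ∀ i x, m ≤ c i x) : HasPointBound c ∅ := by
  intro z
  -- The 3 is the Cauchy–Schwarz cost of summing over three directions; `m⁻¹` compares with unit
  -- conductances.
  refine ⟨3 * (∑ j, ∑' x, urnFlow j x ^ 2) * m⁻¹, fun u hu _ => ?_⟩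
  let k : Fin 3 → Fin d := Fin.castLE hd
  have hk : Function.Injective k := Fin.castLE_injective hd
  -- A copy of the octant with its apex at z, in the first three coordinate directions.
  let emb : (Fin 3 → ℕ) → Fin d → ℤ := fun x => z + ∑ j, Pi.single (k j) (x j : ℤ)
  have hemb_apply : ∀ x j, emb x (k j) = z (k j) + x j := fun x j => by
    simp only [emb, Pi.add_apply, Finset.sum_apply, Pi.single_apply, hk.eq_iff]
    simp
  have hemb : Function.Injective emb := fun x y hxy => funext fun j => by
    have := congrFun hxy (k j)
    rw [hemb_apply, hemb_apply] at this
    omega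
  have hemb_add : ∀ x j, emb (x + Pi.single j 1) = emb x + Pi.single (k j) 1 := fun x j => by
    have h1 : ∀ i : Fin 3, (Pi.single (k i) (((x + Pi.single j 1 : Fin 3 → ℕ) i : ℕ) : ℤ) :
        Fin d → ℤ) = Pi.single (k i) (x i : ℤ) + if i = j then Pi.single (k j) 1 else 0 := by
      intro i
      rcases eq_or_ne i j with rfl | hij
      · simp [Pi.single_add]
      · simp [hij]
    simp only [emb, h1, Finset.sum_add_distrib, Finset.sum_ite_eq', Finset.mem_univ, if_true,
      add_assoc]
  have hemb0 : emb 0 = z := by simp [emb]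
  have hv : (Function.support fun x => u (emb x)).Finite := hu.preimage hemb.injOn
  have hE : Summable fun p => grad u p ^ 2 := by
    simpa [sq] using summable_energy (c := fun _ _ => 1) hu u
  have hpinj : ∀ j, Function.Injective fun x => (k j, emb x) := fun j x y hxy =>
    hemb (Prod.mk.inj hxy).2
  have hgrad : ∀ j x, (u (emb x) - u (emb (x + Pi.single j 1))) ^ 2 = grad u (k j, emb x) ^ 2 :=
    fun j x => by rw [hemb_add, sub_sq_comm]; rfl
  have hsj : ∀ j, Summable fun x => (u (emb x) - u (emb (x + Pi.single j 1))) ^ 2 := fun j => by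
    simp only [hgrad]
    exact hE.comp_injective (hpinj j)
  have henergy : ∑' p, grad u p ^ 2 ≤ m⁻¹ * energy c u u := by
    rw [inv_mul_eq_div, le_div_iff₀' hm, ← tsum_mul_left]
    refine (hE.mul_left m).tsum_le_tsum (fun p => ?_) (summable_energy hu u)
    rw [sq]
    exact mul_le_mul_of_nonneg_right (hc _ _) (mul_self_nonneg _)
  have hj : ∀ j, (∑' x, urnFlow j x * (u (emb x) - u (emb (x + Pi.single j 1)))) ^ 2 ≤
      (∑' x, urnFlow j x ^ 2) * (m⁻¹ * energy c u u) := fun j => by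
    refine (tsum_mul_sq_le (summable_urnFlow_sq j) (hsj j)).2.trans
      (mul_le_mul_of_nonneg_left ?_ (tsum_nonneg fun _ => sq_nonneg _))
    simp only [hgrad]
    exact (tsum_comp_le_tsum_of_inj hE (fun _ => sq_nonneg _) (hpinj j)).trans henergy
  have h0 := sum_tsum_urnFlow_mul hv
  rw [hemb0] at h0
  rw [← h0]
  refine (sq_sum_le_card_mul_sum_sq (s := Finset.univ)).trans ?_
  rw [Finset.card_univ, Fintype.card_fin, mul_assoc, mul_assoc]
  push_cast
  refine mul_le_mul_of_nonneg_left ?_ (by norm_num)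
  rw [Finset.sum_mul]
  exact Finset.sum_le_sum fun j _ => hj j

/-! ### Dimension at most two: logarithmic cut-offs. -/

/-- The supremum norm on `ℤ^d`, with natural number values. -/
def supNorm (z : Fin d → ℤ) : ℕ := Finset.univ.sup fun i => (z i).natAbs

theorem supNorm_le_iff {z : Fin d → ℤ} {k : ℕ} : supNorm z ≤ k ↔ ∀ i, (z i).natAbs ≤ k := by
  simp [supNorm, Finset.sup_le_iff]

theorem supNorm_add_le {z w : Fin d → ℤ} {k : ℕ} (hw : ∀ i, (w i).natAbs ≤ k) :
    supNorm (z + w) ≤ supNorm z + k := by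
  rw [supNorm_le_iff]
  intro i
  exact (Int.natAbs_add_le _ _).trans (add_le_add (supNorm_le_iff.1 le_rfl i) (hw i))

theorem natAbs_single_le (i j : Fin d) : ((Pi.single i 1 : Fin d → ℤ) j).natAbs ≤ 1 := by
  rcases eq_or_ne j i with rfl | h <;> simp [*]

theorem supNorm_add_single_le (z : Fin d → ℤ) (i : Fin d) :
    supNorm (z + Pi.single i 1) ≤ supNorm z + 1 :=
  supNorm_add_le fun j => natAbs_single_le i j

theorem supNorm_le_add_single (z : Fin d → ℤ) (i : Fin d) :
    supNorm z ≤ supNorm (z + Pi.single i 1) + 1 := by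
  have h := supNorm_add_le (z := z + Pi.single i 1) (w := -Pi.single i 1) (k := 1) fun j => by
    rw [Pi.neg_apply, Int.natAbs_neg]
    exact natAbs_single_le i j
  rwa [add_neg_cancel_right] at h

/-- The ball of radius `k` about the origin for the supremum norm. -/
noncomputable def cube (d k : ℕ) : Finset (Fin d → ℤ) :=
  Finset.Icc (fun _ => -(k : ℤ)) fun _ => (k : ℤ)

theorem mem_cube {z : Fin d → ℤ} {k : ℕ} : z ∈ cube d k ↔ supNorm z ≤ k := by
  rw [supNorm_le_iff, cube, Finset.mem_Icc, Pi.le_def, Pi.le_def, ← forall_and]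
  exact forall_congr' fun i => by omega

theorem card_cube (d k : ℕ) : (cube d k).card = (2 * k + 1) ^ d := by
  rw [cube, Pi.card_Icc]
  simp only [Int.card_Icc, Finset.prod_const, Finset.card_univ, Fintype.card_fin]
  congr 1
  omega

/-- Linear growth of spheres is where d ≤ 2 enters: in the plane (2k + 3)² - (2k + 1)² = 8(k + 1).
-/
theorem card_sphere_le (hd : d ≤ 2) {n k : ℕ} (hk : k ≤ n) :
    ((cube d n).filter fun z => supNorm z = k).card ≤ 8 * (k + 1) := by
  cases k with
  | zero =>
    have : ((cube d n).filter fun z => supNorm z = 0) ⊆ cube d 0 := fun z hz =>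
      mem_cube.2 (Finset.mem_filter.1 hz).2.le
    refine (Finset.card_le_card this).trans ?_
    simp [card_cube]
  | succ k =>
    have : ((cube d n).filter fun z => supNorm z = k + 1) ⊆ cube d (k + 1) \ cube d k :=
      fun z hz => by
        have := (Finset.mem_filter.1 hz).2
        rw [Finset.mem_sdiff, mem_cube, mem_cube]
        omega
    refine (Finset.card_le_card this).trans ?_
    rw [Finset.card_sdiff_of_subset fun z hz => by rw [mem_cube] at hz ⊢; omega, card_cube,
      card_cube]
    interval_cases d
    · simp
    · simp only [pow_one]; omega
    · rw [Nat.sub_le_iff_le_add]; nlinarith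

/-- Harmonic numbers, as reals. -/
noncomputable def harm (k : ℕ) : ℝ := ∑ j ∈ Finset.range k, 1 / ((j : ℝ) + 1)

theorem harm_mono : Monotone harm := monotone_nat_of_le_succ fun n => by
  rw [harm, harm, Finset.sum_range_succ]
  have : 0 ≤ 1 / ((n : ℝ) + 1) := by positivity
  linarith

theorem tendsto_harm : Tendsto harm atTop atTop :=
  Real.tendsto_sum_range_one_div_nat_succ_atTop

/-- The factor 2 covers l = k - 1, where the increment is 1 / k ≤ 2 / (k + 1). -/
theorem abs_harm_sub_le {k l : ℕ} (h1 : l ≤ k + 1) (h2 : k ≤ l + 1) :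
    |harm l - harm k| ≤ 2 / ((k : ℝ) + 1) := by
  have hs : ∀ n, harm (n + 1) - harm n = 1 / ((n : ℝ) + 1) := fun n => by
    rw [harm, harm, Finset.sum_range_succ, add_sub_cancel_left]
  have hcases : l = k ∨ l = k + 1 ∨ k = l + 1 := by omega
  rcases hcases with rfl | rfl | rfl
  · rw [sub_self, abs_zero]; positivity
  · rw [hs, abs_of_nonneg (by positivity)]
    gcongr
    norm_num
  · rw [abs_sub_comm, hs, abs_of_nonneg (by positivity), div_le_div_iff₀ (by positivity)
      (by positivity)]
    push_cast
    have : (0 : ℝ) ≤ l := by positivity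
    linarith

/-- Radial logarithmic cut-off on the cube of radius `n`. -/
noncomputable def logCutoff (n : ℕ) (z : Fin d → ℤ) : ℝ :=
  max (1 - harm (supNorm z) / harm n) 0

theorem logCutoff_eq_zero {n : ℕ} (hn : 0 < harm n) {z : Fin d → ℤ} (hz : n ≤ supNorm z) :
    logCutoff n z = 0 := by
  refine max_eq_right ?_
  have : 1 ≤ harm (supNorm z) / harm n := (one_le_div hn).2 (harm_mono hz)
  linarith

theorem harm_pos {n : ℕ} (hn : 0 < n) : 0 < harm n :=
  Finset.sum_pos (fun _ _ => by positivity) ⟨0, Finset.mem_range.2 hn⟩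

theorem logCutoff_zero (n : ℕ) : logCutoff n (0 : Fin d → ℤ) = 1 := by
  have : supNorm (0 : Fin d → ℤ) = 0 := Nat.le_zero.1 (supNorm_le_iff.2 fun i => by simp)
  simp [logCutoff, this, harm]

theorem finite_support_logCutoff {n : ℕ} (hn : 0 < n) :
    (logCutoff n : (Fin d → ℤ) → ℝ).support.Finite :=
  (cube d n).finite_toSet.subset fun z hz => by
    rw [Finset.mem_coe, mem_cube]
    by_contra h
    exact hz (logCutoff_eq_zero (harm_pos hn) (by omega))

theorem tendsto_logCutoff (z : Fin d → ℤ) :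
    Tendsto (fun n => logCutoff n z) atTop (nhds 1) := by
  have h := ((tendsto_harm.const_div_atTop (harm (supNorm z))).const_sub 1).max
    (tendsto_const_nhds (x := (0 : ℝ)))
  simpa [logCutoff] using h

/-- With H = `harm`, the gradient at radius k is at most 2 / ((k + 1) H_n), and there are at most
8(k + 1) such points. Each direction thus contributes at most 32 H_{n+1} / H_n² ≤ 64 / H_n. -/
theorem energy_logCutoff_le (hd : d ≤ 2) {n : ℕ} (hn : 0 < n) :
    energy (fun _ _ => 1) (logCutoff n : (Fin d → ℤ) → ℝ) (logCutoff n) ≤ d * (64 / harm n) := by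
  have hpos := harm_pos hn
  have hgrad : ∀ p : Fin d × (Fin d → ℤ), p ∉ Finset.univ ×ˢ cube d n →
      (1 : ℝ) * (grad (logCutoff n) p * grad (logCutoff n) p) = 0 := by
    rintro ⟨i, z⟩ hp
    rw [Finset.mem_product, mem_cube] at hp
    have hz : n < supNorm z := by simpa using hp
    have h1 := supNorm_le_add_single z i
    have : grad (logCutoff n) (i, z) = 0 := by
      rw [grad, logCutoff_eq_zero hpos (by dsimp only; omega),
        logCutoff_eq_zero hpos (by dsimp only; omega), sub_zero]
    rw [this, mul_zero, mul_zero]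
  have hterm : ∀ p : Fin d × (Fin d → ℤ),
      (1 : ℝ) * (grad (logCutoff n) p * grad (logCutoff n) p) ≤
        (2 / ((supNorm p.2 : ℝ) + 1) / harm n) ^ 2 := by
    rintro ⟨i, z⟩
    rw [one_mul, ← sq]
    have h1 : |grad (logCutoff n) (i, z)| ≤ 2 / ((supNorm z : ℝ) + 1) / harm n := by
      refine (abs_max_sub_max_le_abs _ _ _).trans ?_
      have h2 : (1 - harm (supNorm (z + Pi.single i 1)) / harm n) -
          (1 - harm (supNorm z) / harm n) =
          -((harm (supNorm (z + Pi.single i 1)) - harm (supNorm z)) / harm n) := by ring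
      dsimp only
      rw [h2, abs_neg, abs_div, abs_of_pos hpos]
      gcongr
      exact abs_harm_sub_le (supNorm_add_single_le z i) (supNorm_le_add_single z i)
    rw [← sq_abs]
    exact pow_le_pow_left₀ (abs_nonneg _) h1 2
  have hmaps : ∀ z ∈ cube d n, supNorm z ∈ Finset.range (n + 1) := fun z hz =>
    Finset.mem_range.2 (Nat.lt_succ_of_le (mem_cube.1 hz))
  have hsphere : ∑ z ∈ cube d n, (2 / ((supNorm z : ℝ) + 1) / harm n) ^ 2 ≤ 64 / harm n := by
    rw [← Finset.sum_fiberwise_of_maps_to hmaps]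
    have h1 : ∀ k ∈ Finset.range (n + 1),
        ∑ z ∈ (cube d n).filter (fun z => supNorm z = k),
          (2 / ((supNorm z : ℝ) + 1) / harm n) ^ 2 ≤ 32 / harm n ^ 2 * (1 / ((k : ℝ) + 1)) := by
      intro k hk
      have h2 : ∀ z ∈ (cube d n).filter (fun z => supNorm z = k),
          (2 / ((supNorm z : ℝ) + 1) / harm n) ^ 2 = (2 / ((k : ℝ) + 1) / harm n) ^ 2 :=
        fun z hz => by rw [(Finset.mem_filter.1 hz).2]
      rw [Finset.sum_congr rfl h2, Finset.sum_const, nsmul_eq_mul]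
      have h3 : (((cube d n).filter fun z => supNorm z = k).card : ℝ) ≤ 8 * ((k : ℝ) + 1) := by
        exact_mod_cast card_sphere_le hd (Nat.lt_succ_iff.1 (Finset.mem_range.1 hk))
      refine (mul_le_mul_of_nonneg_right h3 (sq_nonneg _)).trans_eq ?_
      field_simp
      norm_num
    refine (Finset.sum_le_sum h1).trans ?_
    rw [← Finset.mul_sum]
    change 32 / harm n ^ 2 * harm (n + 1) ≤ _
    have h4 : harm (n + 1) ≤ 2 * harm n := by
      have h5 : harm 1 ≤ harm n := harm_mono hn
      have h6 : harm 1 = 1 := by simp [harm]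
      have h7 : harm (n + 1) = harm n + 1 / ((n : ℝ) + 1) := Finset.sum_range_succ _ _
      have h8 : 1 / ((n : ℝ) + 1) ≤ 1 := by
        rw [div_le_one (by positivity)]
        have : (0 : ℝ) ≤ n := by positivity
        linarith
      linarith
    calc 32 / harm n ^ 2 * harm (n + 1) ≤ 32 / harm n ^ 2 * (2 * harm n) := by gcongr
      _ = 64 / harm n := by field_simp; norm_num
  calc energy (fun _ _ => 1) (logCutoff n : (Fin d → ℤ) → ℝ) (logCutoff n)
      = ∑ p ∈ Finset.univ ×ˢ cube d n,
          (1 : ℝ) * (grad (logCutoff n) p * grad (logCutoff n) p) := tsum_eq_sum hgrad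
    _ ≤ ∑ p ∈ (Finset.univ : Finset (Fin d)) ×ˢ cube d n,
          (2 / ((supNorm p.2 : ℝ) + 1) / harm n) ^ 2 := Finset.sum_le_sum fun p _ => hterm p
    _ = ∑ _i : Fin d, ∑ z ∈ cube d n, (2 / ((supNorm z : ℝ) + 1) / harm n) ^ 2 :=
        Finset.sum_product _ _ _
    _ ≤ ∑ _i : Fin d, 64 / harm n := Finset.sum_le_sum fun _ _ => hsphere
    _ = d * (64 / harm n) := by simp

theorem energy_one_translate (u : (Fin d → ℤ) → ℝ) (a : Fin d → ℤ) :
    energy (fun _ _ => 1) (fun x => u (x - a)) (fun x => u (x - a)) =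
      energy (fun _ _ => 1) u u := by
  refine Eq.trans (tsum_congr fun p => ?_)
    (((Equiv.refl (Fin d)).prodCongr (Equiv.subRight a)).tsum_eq _)
  simp [grad, sub_add_eq_add_sub]

/-- In dimension at most two, points have capacity zero. -/
theorem exists_cutoff (hd : d ≤ 2) {c : Fin d → (Fin d → ℤ) → ℝ} (hc0 : ∀ i x, 0 ≤ c i x) {M : ℝ}
    (hM : ∀ i x, c i x ≤ M) (a : Fin d → ℤ) :
    ∃ f : ℕ → (Fin d → ℤ) → ℝ, (∀ k, (f k).support.Finite) ∧ (∀ k, f k a = 1) ∧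
      (∀ x, Tendsto (fun k => f k x) atTop (nhds 1)) ∧
      Tendsto (fun k => energy c (f k) (f k)) atTop (nhds 0) := by
  have hfin : ∀ k : ℕ, (Function.support fun x : Fin d → ℤ => logCutoff (k + 1) (x - a)).Finite :=
    fun k => by
      simpa only [sub_eq_add_neg] using
        finite_support_shift (finite_support_logCutoff k.succ_pos) (-a)
  refine ⟨fun k x => logCutoff (k + 1) (x - a), hfin,
    fun k => by simp only [sub_self, logCutoff_zero],
    fun x => (tendsto_add_atTop_iff_nat 1).2 (tendsto_logCutoff (x - a)), ?_⟩
  have hlim : Tendsto (fun k : ℕ => |M| * (d * (64 / harm (k + 1)))) atTop (nhds 0) := by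
    have h1 : Tendsto (fun k : ℕ => 64 / harm (k + 1)) atTop (nhds 0) :=
      (tendsto_add_atTop_iff_nat (f := fun k => 64 / harm k) 1).2
        (tendsto_harm.const_div_atTop 64)
    simpa using (h1.const_mul (d : ℝ)).const_mul |M|
  refine squeeze_zero (fun k => energy_nonneg hc0 _) (fun k => ?_) hlim
  refine (energy_mono (c' := fun _ _ => |M|) (fun i x => (hM i x).trans (le_abs_self M))
    (hfin k)).trans ?_
  rw [energy_const_mul, energy_one_translate (logCutoff (k + 1)) a]
  exact mul_le_mul_of_nonneg_left (energy_logCutoff_le hd k.succ_pos) (abs_nonneg M)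

/-- If the conductances are bounded below, then a function that vanishes at some point is bounded
at each point by its energy. -/
theorem hasPointBound_singleton {c : Fin d → (Fin d → ℤ) → ℝ} {m : ℝ} (hm : 0 < m)
    (hc : ∀ i x, m ≤ c i x) (a : Fin d → ℤ) : HasPointBound c {a} := by
  intro z
  obtain ⟨C, hC⟩ := exists_sq_sub_le_energy hm hc (z - a)
  refine ⟨C, fun u hu h0 => ?_⟩
  simpa [h0 a rfl] using hC a u hu

/-! ### From the walk to its network. -/

/-- `A` need not be measurable: the restriction of `μ` to `A` is countably additive over the
measurable fibres. -/
theorem hasSum_measureReal_inter_fiber {Ω γ : Type*} [MeasurableSpace Ω] [MeasurableSpace γ]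
    [MeasurableSingletonClass γ] [Countable γ] (μ : Measure Ω) [IsFiniteMeasure μ] {X : Ω → γ}
    (hX : Measurable X) (A : Set Ω) :
    HasSum (fun h => μ.real (A ∩ {ω | X ω = h})) (μ.real A) := by
  have hmeas : ∀ h, MeasurableSet {ω | X ω = h} := fun h => hX (measurableSet_singleton h)
  have h1 : ∑' h, μ (A ∩ {ω | X ω = h}) = μ A := by
    have h2 := measure_iUnion (μ := μ.restrict A) (f := fun h => {ω | X ω = h})
      (fun g h hgh => Set.disjoint_left.2 fun ω hg hh =>
        hgh ((show X ω = g from hg).symm.trans hh)) hmeas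
    have h3 : (⋃ h, {ω | X ω = h}) = Set.univ := Set.eq_univ_of_forall fun ω =>
      Set.mem_iUnion.2 ⟨X ω, rfl⟩
    rw [h3, Measure.restrict_apply_univ] at h2
    rw [h2]
    exact tsum_congr fun h => by rw [Measure.restrict_apply (hmeas h), Set.inter_comm]
  have hne : ∑' h, μ (A ∩ {ω | X ω = h}) ≠ ⊤ := h1 ▸ measure_ne_top μ A
  have h4 := ENNReal.hasSum_toReal hne
  rwa [← ENNReal.tsum_toReal_eq fun h => measure_ne_top _ _, h1] at h4

/-- The reversible measure of the walk with rates `β`. -/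
noncomputable def weight (β : Fin d → ℤ → ℝ) (x : Fin d → ℤ) : ℝ := ∏ j, (β j (x j))⁻¹

/-- The conductance of the edge `(x, x + 1_i)` for the walk with rates `β`. -/
noncomputable def cond (β : Fin d → ℤ → ℝ) (i : Fin d) (x : Fin d → ℤ) : ℝ :=
  ∏ j ∈ Finset.univ.erase i, (β j (x j))⁻¹

theorem weight_pos {β : Fin d → ℤ → ℝ} (hβ : ∀ i k, 0 < β i k) (x : Fin d → ℤ) :
    0 < weight β x :=
  Finset.prod_pos fun j _ => inv_pos.2 (hβ j _)

theorem cond_eq {β : Fin d → ℤ → ℝ} (hβ : ∀ i k, 0 < β i k) (i : Fin d) (x : Fin d → ℤ) :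
    cond β i x = weight β x * β i (x i) := by
  rw [weight, ← Finset.mul_prod_erase _ _ (Finset.mem_univ i), cond]
  field_simp [(hβ i (x i)).ne']

/-- The product omits the factor at i, the only one that a move along i changes. With `cond_eq` this
is detailed balance. -/
theorem cond_add_single (β : Fin d → ℤ → ℝ) (i : Fin d) (x : Fin d → ℤ) (a : ℤ) :
    cond β i (x + Pi.single i a) = cond β i x :=
  Finset.prod_congr rfl fun j hj => by simp [Finset.ne_of_mem_erase hj]

theorem cond_bounds {β : Fin d → ℤ → ℝ} {b B : ℝ} (hb : 0 < b) (hβ : ∀ i k, b ≤ β i k ∧ β i k ≤ B)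
    (i : Fin d) (x : Fin d → ℤ) :
    B⁻¹ ^ (d - 1) ≤ cond β i x ∧ cond β i x ≤ b⁻¹ ^ (d - 1) := by
  have hcard : (Finset.univ.erase i).card = d - 1 := by simp
  have hB : 0 < B := hb.trans_le ((hβ i 0).1.trans (hβ i 0).2)
  constructor
  · rw [← hcard, ← Finset.prod_const]
    exact Finset.prod_le_prod (fun _ _ => (inv_pos.2 hB).le) fun j _ =>
      inv_anti₀ (hb.trans_le (hβ j _).1) (hβ j _).2
  · rw [← hcard, ← Finset.prod_const]
    exact Finset.prod_le_prod (fun j _ => (inv_pos.2 (hb.trans_le (hβ j _).1)).le) fun j _ =>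
      inv_anti₀ hb (hβ j _).1

/-- The forward equation: one step of the walk acts on densities with respect to `weight β` as
the identity minus the network Laplacian. -/
theorem hasSum_mul_stepProb {β : Fin d → ℤ → ℝ} (hβ : ∀ i k, 0 < β i k) (a : (Fin d → ℤ) → ℝ)
    (y : Fin d → ℤ) :
    HasSum (fun z => a z * stepProb β z (y - z))
      (a y - lap (cond β) (fun x => a x / weight β x) y) := by
  have hsingle : ∀ (w : Fin d → ℤ) (f : (Fin d → ℤ) → ℝ),
      HasSum (fun z => if z = w then f z else 0) (f w) := fun w f => by
    have h := hasSum_ite_eq w (f w)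
    convert h using 2 with z
    split_ifs with hz
    · rw [hz]
    · rfl
  have h1 := (hasSum_sum fun i (_ : i ∈ Finset.univ) =>
    (hsingle (y - Pi.single i 1) fun z => a z * β i (z i)).add
      (hsingle (y + Pi.single i 1) fun z => a z * β i (z i))).add
      (hsingle y fun z => a z * (1 - 2 * ∑ i, β i (z i)))
  have hterm : ∀ z, a z * stepProb β z (y - z) =
      (∑ i, ((if z = y - Pi.single i 1 then a z * β i (z i) else 0) +
        if z = y + Pi.single i 1 then a z * β i (z i) else 0)) +
      if z = y then a z * (1 - 2 * ∑ i, β i (z i)) else 0 := fun z => by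
    have e1 : ∀ i : Fin d, y - z = Pi.single i 1 ↔ z = y - Pi.single i 1 := fun i =>
      ⟨fun h => by rw [← h]; abel, fun h => by rw [h]; abel⟩
    have e2 : ∀ i : Fin d, y - z = -Pi.single i 1 ↔ z = y + Pi.single i 1 := fun i =>
      ⟨fun h => by rw [← neg_eq_iff_eq_neg] at h; rw [← h]; abel, fun h => by rw [h]; abel⟩
    have e3 : y - z = 0 ↔ z = y := by rw [sub_eq_zero, eq_comm]
    simp only [stepProb, e1, e2, e3, mul_add, Finset.mul_sum, mul_ite, mul_zero]
  have hval : (∑ i, (a (y - Pi.single i 1) * β i ((y - Pi.single i 1 : Fin d → ℤ) i) +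
      a (y + Pi.single i 1) * β i ((y + Pi.single i 1 : Fin d → ℤ) i))) +
      a y * (1 - 2 * ∑ i, β i (y i)) = a y - lap (cond β) (fun x => a x / weight β x) y := by
    -- Mass sent along an edge is conductance times density; by detailed balance the incoming terms
    -- assemble into the Laplacian.
    have hrev : ∀ (i : Fin d) (x : Fin d → ℤ), a x * β i (x i) = cond β i x * (a x / weight β x) :=
      fun i x => by
        rw [cond_eq hβ]
        field_simp [(weight_pos hβ x).ne']
    have hm : ∀ i, cond β i (y - Pi.single i 1) = cond β i y := fun i => by
      rw [← cond_add_single β i (y - Pi.single i 1) 1, sub_add_cancel]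
    have hlap : lap (cond β) (fun x => a x / weight β x) y = ∑ i, (2 * (a y * β i (y i)) -
        a (y + Pi.single i 1) * β i ((y + Pi.single i 1 : Fin d → ℤ) i) -
        a (y - Pi.single i 1) * β i ((y - Pi.single i 1 : Fin d → ℤ) i)) :=
      Finset.sum_congr rfl fun i _ => by
        rw [hrev, hrev, hrev, hm, cond_add_single]
        ring
    rw [hlap, Finset.sum_sub_distrib, Finset.sum_sub_distrib, Finset.sum_add_distrib,
      ← Finset.mul_sum, ← Finset.mul_sum]
    ring
  rw [← hval]
  simpa only [hterm] using h1

namespace IsWalk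

variable {β : Fin d → ℤ → ℝ} {Ω : Type*} [MeasurableSpace Ω] {μ : Measure Ω}
  [IsProbabilityMeasure μ] {S : ℕ → Ω → Fin d → ℤ}

/-- The Markov property at time `t`, for an arbitrary event of the history up to `t`. -/
theorem measureReal_step (hS : IsWalk β μ S) (t : ℕ) (B : Set (Fin (t + 1) → Fin d → ℤ))
    (z v : Fin d → ℤ) :
    μ.real {ω | (fun s : Fin (t + 1) => S s ω) ∈ B ∧ S t ω = z ∧ S (t + 1) ω - S t ω = v} =
      μ.real {ω | (fun s : Fin (t + 1) => S s ω) ∈ B ∧ S t ω = z} * stepProb β z v := by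
  have hX : Measurable fun ω => fun s : Fin (t + 1) => S s ω :=
    measurable_pi_lambda _ fun s => hS.measurable s
  refine (hasSum_measureReal_inter_fiber μ hX _).unique ?_
  have hR := (hasSum_measureReal_inter_fiber μ hX
    {ω | (fun s : Fin (t + 1) => S s ω) ∈ B ∧ S t ω = z}).mul_right (stepProb β z v)
  refine (congrArg (HasSum · _) (funext fun g => ?_)).mpr hR
  -- Splitting over complete histories g reduces the claim to `hS.step`; the value 0 after time t is
  -- never read.
  let x : ℕ → Fin d → ℤ := fun s => if hs : s < t + 1 then g ⟨s, hs⟩ else 0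
  have hx : ∀ ω, (fun s : Fin (t + 1) => S s ω) = g ↔ ∀ s ≤ t, S s ω = x s := fun ω => by
    constructor
    · rintro h s hs
      simp only [x, dif_pos (Nat.lt_succ_of_le hs), ← h]
    · intro h
      ext1 s
      simp only [h s (Nat.le_of_lt_succ s.2), x, dif_pos s.2]
  by_cases hg : g ∈ B ∧ x t = z
  · have hstep := hS.step t x v
    rw [hg.2] at hstep
    refine (congrArg μ.real (Set.ext fun ω => ?_)).trans
      (hstep.trans (congrArg (μ.real · * stepProb β z v) (Set.ext fun ω => ?_)))
    · refine ⟨fun h => ⟨(hx ω).1 h.2, h.1.2.2⟩,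
        fun h => ⟨⟨?_, (h.1 t le_rfl).trans hg.2, h.2⟩, (hx ω).2 h.1⟩⟩
      rw [(hx ω).2 h.1]
      exact hg.1
    · refine ⟨fun h => ⟨⟨?_, (h t le_rfl).trans hg.2⟩, (hx ω).2 h⟩, fun h => (hx ω).1 h.2⟩
      rw [(hx ω).2 h]
      exact hg.1
  · have hbad : ∀ ω, (fun s : Fin (t + 1) => S s ω) = g →
        (fun s : Fin (t + 1) => S s ω) ∈ B → S t ω ≠ z := fun ω h1 h2 h3 =>
      hg ⟨h1 ▸ h2, ((hx ω).1 h1 t le_rfl).symm.trans h3⟩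
    refine (congrArg μ.real (Set.eq_empty_of_forall_notMem fun ω h =>
      hbad ω h.2 h.1.1 h.1.2.1)).trans (Eq.trans ?_ (congrArg (μ.real · * stepProb β z v)
        (Set.eq_empty_of_forall_notMem fun ω h => hbad ω h.2 h.1.1 h.1.2)).symm)
    simp

/-- The forward equation, restricted to an arbitrary event of the history. -/
theorem measureReal_forward (hS : IsWalk β μ S) (hβ : ∀ i k, 0 < β i k) (t : ℕ)
    (B : Set (Fin (t + 1) → Fin d → ℤ)) (y : Fin d → ℤ) :
    μ.real {ω | (fun s : Fin (t + 1) => S s ω) ∈ B ∧ S (t + 1) ω = y} =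
      μ.real {ω | (fun s : Fin (t + 1) => S s ω) ∈ B ∧ S t ω = y} -
        lap (cond β) (fun x => μ.real {ω | (fun s : Fin (t + 1) => S s ω) ∈ B ∧ S t ω = x} /
          weight β x) y := by
  refine (hasSum_measureReal_inter_fiber μ (hS.measurable t) _).unique ?_
  have h := hasSum_mul_stepProb hβ
    (fun x => μ.real {ω | (fun s : Fin (t + 1) => S s ω) ∈ B ∧ S t ω = x}) y
  have h1 : ∀ z, {ω | (fun s : Fin (t + 1) => S s ω) ∈ B ∧ S (t + 1) ω = y} ∩ {ω | S t ω = z} =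
      {ω | (fun s : Fin (t + 1) => S s ω) ∈ B ∧ S t ω = z ∧ S (t + 1) ω - S t ω = y - z} := by
    intro z
    ext ω
    constructor
    · rintro ⟨⟨h1, h2⟩, h3⟩
      exact ⟨h1, h3, by rw [h2, show S t ω = z from h3]⟩
    · rintro ⟨h1, h2, h3⟩
      exact ⟨⟨h1, by rw [h2] at h3; exact sub_left_injective h3⟩, h2⟩
  simpa only [h1, hS.measureReal_step] using h

/-- The forward equation makes each law vanish away from the previous support and its neighbours.
This keeps every spatial sum in the killed evolution finite. -/
theorem finite_support_law (hS : IsWalk β μ S) (hβ : ∀ i k, 0 < β i k) (t : ℕ) :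
    (Function.support fun y => μ.real {ω | S t ω = y}).Finite := by
  induction t with
  | zero =>
    refine (Set.finite_singleton 0).subset fun y hy => ?_
    by_contra hne
    refine hy ((measureReal_eq_zero_iff).2 (measure_mono_null (t := {ω | ¬S 0 ω = 0})
      (fun ω hω h0 => ?_) hS.start))
    exact hne ((show S 0 ω = y from hω).symm.trans h0)
  | succ t ih =>
    have h := hS.measureReal_forward hβ t Set.univ
    simp only [Set.mem_univ, true_and] at h
    have hsub : ∀ v : Fin d → ℤ,
        (Function.support fun x => μ.real {ω | S t ω = x + v}).Finite := fun v =>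
      finite_support_shift ih v
    refine (ih.union (Set.finite_iUnion fun i : Fin d =>
      (hsub (Pi.single i 1)).union (hsub (-Pi.single i 1)))).subset fun y hy => ?_
    by_contra hne
    simp only [Set.mem_union, Set.mem_iUnion, Function.mem_support, not_or, not_exists,
      not_not, ← sub_eq_add_neg] at hne
    refine hy ?_
    simp only [h, lap, hne.1, (hne.2 _).1, (hne.2 _).2]
    simp

/-- Laws of the walk from time `m` on, killed on entering `K`. -/
theorem isKilledEvolution (hS : IsWalk β μ S) (hβ : ∀ i k, 0 < β i k) (m : ℕ)
    (K : Set (Fin d → ℤ)) :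
    IsKilledEvolution (cond β) (weight β) K
      (fun n y => μ.real {ω | (∀ s, m ≤ s → s ≤ m + n → S s ω ∉ K) ∧ S (m + n) ω = y}) where
  cond_nonneg i x := Finset.prod_nonneg fun j _ => (inv_pos.2 (hβ j _)).le
  cond_shift i x := cond_add_single β i x 1
  weight_pos := weight_pos hβ
  nonneg n x := measureReal_nonneg
  finite_support n := (hS.finite_support_law hβ (m + n)).subset fun y hy h0 => by
    refine hy (le_antisymm (le_trans (measureReal_mono fun ω hω => hω.2) h0.le) measureReal_nonneg)
  killed n x hx := by
    have : {ω | (∀ s, m ≤ s → s ≤ m + n → S s ω ∉ K) ∧ S (m + n) ω = x} = ∅ :=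
      Set.eq_empty_of_forall_notMem fun ω hω =>
        hω.1 (m + n) (Nat.le_add_right _ _) le_rfl (hω.2 ▸ hx)
    rw [this, measureReal_empty]
  step n y hy := by
    have h := hS.measureReal_forward hβ (m + n)
      {g | ∀ s : Fin (m + n + 1), m ≤ (s : ℕ) → g s ∉ K} y
    have hiff : ∀ ω, (fun s : Fin (m + n + 1) => S s ω) ∈
        {g : Fin (m + n + 1) → Fin d → ℤ | ∀ s : Fin (m + n + 1), m ≤ (s : ℕ) → g s ∉ K} ↔
        ∀ s, m ≤ s → s ≤ m + n → S s ω ∉ K := fun ω =>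
      ⟨fun h s h1 h2 => h ⟨s, Nat.lt_succ_of_le h2⟩ h1,
        fun h s h1 => h s h1 (Nat.le_of_lt_succ s.2)⟩
    simp only [hiff] at h
    rw [← h]
    congr 1
    ext ω
    -- Since y ∉ `K`, being at y at the new time already includes survival at that time.
    refine and_congr_left fun hω => ⟨fun h s h1 h2 => h s h1 (h2.trans (Nat.le_succ _)),
      fun h s h1 h2 => ?_⟩
    rcases Nat.lt_or_ge (m + n) s with h3 | h3
    · rw [show s = m + (n + 1) by omega]
      exact fun hK => hy ((show S (m + (n + 1)) ω = y from hω) ▸ hK)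
    · exact h s h1 h3

/-! ### Recurrence and transience for bounded rates. -/

/-- A walk with rates bounded above and below is recurrent in dimension at most two. -/
theorem isRecurrent (hS : IsWalk β μ S) (hd : d ≤ 2) {b B : ℝ} (hb : 0 < b)
    (hB : ∀ i k, b ≤ β i k ∧ β i k ≤ B) :
    IsRecurrent μ S := by
  have hβ : ∀ i k, 0 < β i k := fun i k => hb.trans_le (hB i k).1
  have hnull : ∀ (x : Fin d → ℤ) (m : ℕ), ∀ᵐ ω ∂μ, ∃ t ≥ m, S t ω = x := by
    intro x m
    have hev := hS.isKilledEvolution hβ m {x}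
    -- `B ≤ 0` is possible only for d = 0, where there is no index i and any positive constant
    -- serves.
    have hlow : ∃ c₀ > 0, ∀ i y, c₀ ≤ cond β i y := by
      rcases le_or_gt B 0 with h0 | h0
      · exact ⟨1, one_pos, fun i y => absurd (hB i 0).2 (by linarith [hβ i 0])⟩
      · exact ⟨_, pow_pos (inv_pos.2 h0) _, fun i y => (cond_bounds hb hB i y).1⟩
    obtain ⟨c₀, hc₀, hc⟩ := hlow
    obtain ⟨f, hf, hf1, hlim, hE⟩ := exists_cutoff hd hev.cond_nonneg
      (fun i y => (cond_bounds hb hB i y).2) x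
    have hmass := hev.tendsto_mass (hasPointBound_singleton hc₀ hc x) hf
      (fun k y hy => by rw [Set.mem_singleton_iff.1 hy]; exact hf1 k) hlim hE
    have hle : ∀ n, μ.real {ω | ∀ t ≥ m, S t ω ≠ x} ≤ ∑' y,
        μ.real {ω | (∀ s, m ≤ s → s ≤ m + n → S s ω ∉ ({x} : Set (Fin d → ℤ))) ∧
          S (m + n) ω = y} := fun n => by
      have h1 := (hasSum_measureReal_inter_fiber μ (hS.measurable (m + n))
        {ω | ∀ s, m ≤ s → s ≤ m + n → S s ω ∉ ({x} : Set (Fin d → ℤ))}).tsum_eq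
      refine le_trans (measureReal_mono (s₂ := {ω | ∀ s, m ≤ s → s ≤ m + n →
        S s ω ∉ ({x} : Set (Fin d → ℤ))}) fun ω hω s h1 _ => hω s h1) h1.symm.le
    have hzero : μ.real {ω | ∀ t ≥ m, S t ω ≠ x} = 0 :=
      le_antisymm (ge_of_tendsto' hmass hle) measureReal_nonneg
    rw [measureReal_eq_zero_iff] at hzero
    rw [ae_iff]
    simpa using hzero
  have hall := ae_all_iff.2 fun x => ae_all_iff.2 (hnull x)
  filter_upwards [hall] with ω hω x
  rw [frequently_atTop]
  exact hω x

/-- A walk with rates bounded above and below is transient in dimension at least three. -/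
theorem isTransient (hS : IsWalk β μ S) (hd : 3 ≤ d) {b B : ℝ} (hb : 0 < b)
    (hB : ∀ i k, b ≤ β i k ∧ β i k ≤ B) :
    IsTransient μ S := by
  have hβ : ∀ i k, 0 < β i k := fun i k => hb.trans_le (hB i k).1
  have hB0 : 0 < B := hb.trans_le ((hB ⟨0, by omega⟩ 0).1.trans (hB _ 0).2)
  have hev := hS.isKilledEvolution hβ 0 ∅
  have hK := hasPointBound_empty hd (pow_pos (inv_pos.2 hB0) (d - 1))
    fun i y => (cond_bounds hb hB i y).1
  refine ae_all_iff.2 fun x => ?_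
  have hsum := hev.summable_visits hK x
  simp only [Set.mem_empty_iff_false, not_false_eq_true, implies_true, true_and, zero_add] at hsum
  have hfin : ∑' n, μ {ω | S n ω = x} ≠ ⊤ := by
    have := hsum.tsum_ofReal_ne_top
    simpa only [ofReal_measureReal (measure_ne_top μ _)] using this
  -- Borel–Cantelli.
  have h0 := measure_setOfPred_frequently_eq_zero hfin
  rw [ae_iff]
  simpa only [not_eventually, not_not] using h0

end IsWalk

theorem exists_rate_bounds {α δ : Fin d → ℝ} (hδ : ∀ i, 0 ≤ δ i)
    (hαδ : ∀ i, 0 < α i - δ i / 2) :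
    ∃ b B : ℝ, 0 < b ∧ ∀ i k, (b ≤ rateModel2 α δ i k ∧ rateModel2 α δ i k ≤ B) ∧
      b ≤ rateModel3 α δ i k ∧ rateModel3 α δ i k ≤ B := by
  obtain ⟨b, hb, hle⟩ : ∃ b > 0, ∀ i, b ≤ α i - δ i / 2 := by
    -- Every sufficiently small positive b lies below the finitely many positive numbers, even when
    -- the index set is empty.
    have h := ((eventually_all (ι := Fin d)).2 fun i => gt_mem_nhds (hαδ i)).filter_mono
      (nhdsWithin_le_nhds (s := Set.Ioi 0))
    obtain ⟨b, hb, hlt⟩ := (h.and self_mem_nhdsWithin).exists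
    exact ⟨b, hlt, fun i => (hb i).le⟩
  refine ⟨b, ∑ i, α i, hb, fun i k => ?_⟩
  have hα : ∀ i, 0 ≤ α i := fun i => by linarith [hαδ i, hδ i]
  have h1 : α i ≤ ∑ i, α i := Finset.single_le_sum (fun i _ => hα i) (Finset.mem_univ i)
  have h2 := hle i
  have h3 := hδ i
  unfold rateModel2 rateModel3
  split_ifs <;> refine ⟨⟨?_, ?_⟩, ?_, ?_⟩ <;> linarith

end LatticeWalk

theorem proposition4 {d : ℕ} (α δ : Fin d → ℝ)
    (hα : 2 * ∑ i, α i = 1) (hδ : ∀ i, 0 ≤ δ i) (hαδ : ∀ i, 0 < α i - δ i / 2)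
    {Ω : Type*} [MeasurableSpace Ω] (μ : Measure Ω) [IsProbabilityMeasure μ]
    (S : ℕ → Ω → Fin d → ℤ)
    (hS : LatticeWalk.IsWalk (LatticeWalk.rateModel2 α δ) μ S ∨
      LatticeWalk.IsWalk (LatticeWalk.rateModel3 α δ) μ S) :
    (d ≤ 2 → LatticeWalk.IsRecurrent μ S) ∧ (3 ≤ d → LatticeWalk.IsTransient μ S) := by
  obtain ⟨b, B, hb, hB⟩ := LatticeWalk.exists_rate_bounds hδ hαδ
  rcases hS with hS | hS
  · exact ⟨fun hd => hS.isRecurrent hd hb fun i k => (hB i k).1,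
      fun hd => hS.isTransient hd hb fun i k => (hB i k).1⟩
  · exact ⟨fun hd => hS.isRecurrent hd hb fun i k => (hB i k).2,
      fun hd => hS.isTransient hd hb fun i k => (hB i k).2⟩
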